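/- \textbf{Theorem (Zero-free prime windows beyond a $q$-dependent threshold).} For $i\ge 2$ and $x\in\mathbb R$ let \[ \phi_i(x)=\frac{1}{i^2}\Big(i+2\sum_{k=1}^{i-1}(i-k)\cos\frac{2\pi kx}{i}\Big), \] which equals $\frac1{i^2}\big(\frac{\sin \pi x}{\sin(\pi x/i)}\big)^2$ with its removable singularities filled in. For real $q>1$ let \[ S_q(x)=\sum_{i\ge2}q^{-i}\phi_i(x),\qquad S_1(x)=\frac{\sin(2\pi x)}{2\pi}, \] where $S_1$ is a separate function, not the value of $S_q$ at $q=1$, and define the tangent-matched indicator \[ F^{\sharp}(x,q)=(q-1)q\Big(S_q(x)-q^{-x}\big(1+(\log q)\,S_1(x)\big)\Big). \] Put \[ \Sigma(q)=\sum_{i\ge2}\frac{q^{-i}}{i^2},\qquad \Lambda_{\sin}(q)=1+\frac{\log q}{2\pi}, \] \[ C'_{\sin}(q)=\frac12\Big(\frac{\pi^2}{2}q^{-2}+\frac{8\pi^2}{27}q^{-3}+\frac{\pi^2}{4}q^{-4}-\Big(\frac{2\pi^2}{3}+(\log q)^2\Big)q^{-5}\Big),\qquad K_0(q)=\tfrac12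 C'_{\sin}(q), \] \[ C_3^{\mathrm{tot}}(q)=4\pi^3\frac{q^{-2}}{1-1/q}+(\log q)^3\Big(4+\frac{\log q}{2\pi}\Big)+6\pi(\log q)^2+4\pi^2\log q, \] \[ \delta_{\sin}(q)=\min\Big\{1,\frac{3K_0(q)}{C_3^{\mathrm{tot}}(q)}\Big\},\qquad \alpha(q)=\min\Big\{\frac14,\frac{\delta_{\sin}(q)}2\Big\}, \] \[ P_0(q)=\max\left\{3+\frac{\log\Big(\frac{\Lambda_{\sin}(q)}{\cos^2(\pi\alpha(q)/2)}\Big)}{\log q},\; 1+\alpha(q)+\frac{\log\Big(\frac{\Lambda_{\sin}(q)}{\sin^2(\pi\alpha(q))\,\Sigma(q)}\Big)}{\log q},\;5\right\}. \] Then for every real $q>1$ and every odd prime $p\ge P_0(q)$, \[ F^{\sharp}(x,q)>0\quad\text{for all }x\in(p-1,p),\qquad\text{and}\qquad F^{\sharp}(p,q)=0. \] In particular, $F^{\sharp}(\cdot,q)$ has no real zero in $(p-1,p)$ for any odd prime $p\ge P_0(q)$. -/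

import Mathlib

noncomputable section

namespace FejerIndicator

/-- The Fejér term `F(x,i) = i + 2 ∑_{k=1}^{i-1} (i-k) cos(2πkx/i)`, the everywhere-defined form of
`(sin(πx)/sin(πx/i))²`. -/
def fejer (x : ℝ) (i : ℕ) : ℝ :=
  (i : ℝ) + 2 * ∑ k ∈ Finset.Ico 1 i, ((i : ℝ) - (k : ℝ)) * Real.cos (2 * Real.pi * k * x / i)

/-- `φ_i(x) = F(x,i)/i²`. -/
def phi (i : ℕ) (x : ℝ) : ℝ := fejer x i / (i : ℝ) ^ 2

/-- `S_q(x) = ∑_{i ≥ 2} q^{-i} φ_i(x)`; the summation index is shifted by two. -/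
def fejerSum (q x : ℝ) : ℝ := ∑' j : ℕ, (q ^ (j + 2))⁻¹ * phi (j + 2) x

/-- The periodic normalizer `S_1(x) = sin(2πx)/(2π)`. -/
def periodicNormalizer (x : ℝ) : ℝ := Real.sin (2 * Real.pi * x) / (2 * Real.pi)

/-- The corrector `C_sin(x,q) = (q-1) q q^{-x} (1 + (log q) S_1(x))`. -/
def corrector (x q : ℝ) : ℝ :=
  (q - 1) * q * q ^ (-x) * (1 + Real.log q * periodicNormalizer x)

/-- The tangent-matched indicator `F♯(x,q) = (q-1) q S_q(x) - C_sin(x,q)`. -/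
def FSharp (x q : ℝ) : ℝ := (q - 1) * q * fejerSum q x - corrector x q

/-- `Σ(q) = ∑_{i ≥ 2} q^{-i}/i²`; the summation index is shifted by two. -/
def fejerMass (q : ℝ) : ℝ := ∑' j : ℕ, (q ^ (j + 2))⁻¹ / ((j + 2 : ℕ) : ℝ) ^ 2

/-- `Λ_sin(q) = 1 + log q/(2π)`. -/
def LambdaSin (q : ℝ) : ℝ := 1 + Real.log q / (2 * Real.pi)

/-- The curvature constant `C'_sin(q)`. -/
def CSin' (q : ℝ) : ℝ :=
  (1 / 2) * (Real.pi ^ 2 / 2 * (q ^ 2)⁻¹ + 8 * Real.pi ^ 2 / 27 * (q ^ 3)⁻¹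
    + Real.pi ^ 2 / 4 * (q ^ 4)⁻¹
    - (2 * Real.pi ^ 2 / 3 + Real.log q ^ 2) * (q ^ 5)⁻¹)

/-- `K_0(q) = C'_sin(q)/2`. -/
def K0 (q : ℝ) : ℝ := CSin' q / 2

/-- The third-derivative constant `C_3^tot(q)`. -/
def C3tot (q : ℝ) : ℝ :=
  4 * Real.pi ^ 3 * ((q ^ 2)⁻¹ / (1 - 1 / q))
    + Real.log q ^ 3 * (4 + Real.log q / (2 * Real.pi))
    + 6 * Real.pi * Real.log q ^ 2 + 4 * Real.pi ^ 2 * Real.log q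

/-- The radius `δ_sin(q) = min {1, 3 K_0(q)/C_3^tot(q)}`. -/
def deltaSin (q : ℝ) : ℝ := min 1 (3 * K0 q / C3tot q)

/-- `α(q) = min {1/4, δ_sin(q)/2}`. -/
def alpha (q : ℝ) : ℝ := min (1 / 4) (deltaSin q / 2)

/-- The threshold `P_0(q)`. -/
def P0 (q : ℝ) : ℝ :=
  max (3 + Real.log (LambdaSin q / Real.cos (Real.pi * alpha q / 2) ^ 2) / Real.log q)
    (max
      (1 + alpha q
        + Real.log (LambdaSin q / (Real.sin (Real.pi * alpha q) ^ 2 * fejerMass q)) / Real.log q)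
      5)

theorem abs_fejer_le (x : ℝ) (i : ℕ) : |fejer x i| ≤ (i : ℝ) ^ 2 := by
  have hsum : ∀ n : ℕ, (n : ℝ) + 2 * ∑ k ∈ Finset.Ico 1 n, ((n : ℝ) - (k : ℝ)) = (n : ℝ) ^ 2 := by
    intro n
    have h : ∀ m : ℕ, ∑ k ∈ Finset.range (m + 1), ((n : ℝ) - (k : ℝ))
        = (m + 1) * n - m * (m + 1) / 2 := by
      intro m
      induction m with
      | zero => simp
      | succ m ih => rw [Finset.sum_range_succ, ih]; push_cast; ring
    rcases n with _ | n
    · simp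
    · have h2 := h n
      rw [Finset.range_eq_Ico, Finset.sum_eq_sum_Ico_succ_bot (Nat.succ_pos n)] at h2
      push_cast at h2 ⊢
      linarith
  have hterm : |∑ k ∈ Finset.Ico 1 i, ((i : ℝ) - (k : ℝ)) * Real.cos (2 * Real.pi * k * x / i)|
      ≤ ∑ k ∈ Finset.Ico 1 i, ((i : ℝ) - (k : ℝ)) := by
    refine (Finset.abs_sum_le_sum_abs _ _).trans (Finset.sum_le_sum ?_)
    intro k hk
    have hk' : (k : ℝ) ≤ i := by exact_mod_cast (Finset.mem_Ico.mp hk).2.le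
    rw [abs_mul, abs_of_nonneg (by linarith : (0 : ℝ) ≤ (i : ℝ) - k)]
    exact mul_le_of_le_one_right (by linarith) (Real.abs_cos_le_one _)
  have hi := hsum i
  have hi0 : (0 : ℝ) ≤ i := Nat.cast_nonneg i
  rw [abs_le] at hterm
  unfold fejer
  rw [abs_le]
  constructor <;> linarith [hterm.1, hterm.2]

/-- For `q > 1` the series defining `S_q(x)` converges, so `fejerSum` is its actual sum. -/
theorem summable_fejerSum {q : ℝ} (hq : 1 < q) (x : ℝ) :
    Summable fun j : ℕ => (q ^ (j + 2))⁻¹ * phi (j + 2) x := by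
  have hg : Summable fun j : ℕ => (q⁻¹) ^ (j + 2) :=
    (summable_nat_add_iff 2).mpr
      (summable_geometric_of_lt_one (by positivity) (inv_lt_one_of_one_lt₀ hq))
  refine Summable.of_norm_bounded hg fun j => ?_
  have hphi : |phi (j + 2) x| ≤ 1 := by
    have hpos : (0 : ℝ) < ((j + 2 : ℕ) : ℝ) ^ 2 := by positivity
    unfold phi
    rw [abs_div, abs_of_pos hpos, div_le_one hpos]
    exact abs_fejer_le x (j + 2)
  have hq0 : (0 : ℝ) ≤ (q ^ (j + 2))⁻¹ := by positivity
  rw [Real.norm_eq_abs, abs_mul, abs_of_nonneg hq0, inv_pow]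
  exact mul_le_of_le_one_right hq0 hphi

/-- For `q > 1` the series defining `Σ(q)` converges, so `fejerMass` is its actual sum. -/
theorem summable_fejerMass {q : ℝ} (hq : 1 < q) :
    Summable fun j : ℕ => (q ^ (j + 2))⁻¹ / ((j + 2 : ℕ) : ℝ) ^ 2 := by
  have hg : Summable fun j : ℕ => (q⁻¹) ^ (j + 2) :=
    (summable_nat_add_iff 2).mpr
      (summable_geometric_of_lt_one (by positivity) (inv_lt_one_of_one_lt₀ hq))
  refine Summable.of_nonneg_of_le (fun j => by positivity) (fun j => ?_) hg
  rw [inv_pow]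
  refine div_le_self (by positivity) ?_
  have h1 : (1 : ℝ) ≤ ((j + 2 : ℕ) : ℝ) := by exact_mod_cast (by omega : 1 ≤ j + 2)
  exact one_le_pow₀ h1

end FejerIndicator

end

/-!
Write `L = log q`, so that `F♯(x,q) = (q-1) q (S_q(x) - q^{-x} (1 + L S_1(x)))`; only the sign of
the bracket matters. Everything rests on the closed form
`fejer x i * sin² (π x / i) = sin² (π x)` (`fejer_mul_sin_sq`). It shows that every `φ_i` is
nonnegative, that `φ_i(x) ≥ sin² (π x) / i²`, and that at an integer `n` the value `φ_i(n)` is `1` or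
`0` according to whether `i ∣ n`. At a prime `p` only the index `i = p` survives, so
`S_q(p) = q^{-p}`, which is the value of the corrector there (`FSharp_prime`).

The window `(p-1, p)` is split into three parts, with `α = α(q) ∈ (0, 1/4]`.

* On `(p-1, p-1+α]` the term `φ_2(x) = cos² (π x / 2)` is at least `cos² (π α / 2)` because `p-1` is
  even, and the first entry of `P_0(q)` makes `q^{-2} cos² (π α / 2)` exceed the crude bound
  `q^{-x} Λ_sin(q)` for the corrector.
* On `[p-1+α, p-α]` the lower bounds `sin² (π α) / i²` sum to `sin² (π α) Σ(q)`, which beats the same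
  crude bound by the second entry of `P_0(q)`.
* Near `p`, put `x = p - t` with `0 < t ≤ 1/4`. The corrector agrees with `q^{-p} φ_p` to first
  order in `t`: from `e^s (1 - s) ≤ 1` the corrector exceeds `q^{-p}` by at most a cubic error, while
  `φ_p(x) ≥ 1 - π² t² / 3`. These losses are outweighed by the terms `i = 2, 3, 4`
  of `S_q`, each at least a constant times `q^{-i} t²`, where `q^{-i} > q^{-p}` as `p ≥ 5`
  (`corrector_lt_fejerSum_near_prime`). The radius `1/4` works for every `q`, so the Taylor radius
  `δ_sin(q)` enters only through the positivity of `α`.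
-/

noncomputable section

namespace FejerIndicator

/-! ### The closed form of the Fejér kernel -/

theorem one_add_two_sum_cos_mul_sin (n : ℕ) (θ : ℝ) :
    (1 + 2 * ∑ k ∈ Finset.Ico 1 (n + 1), Real.cos (2 * k * θ)) * Real.sin θ
      = Real.sin ((2 * n + 1) * θ) := by
  induction n with
  | zero => simp
  | succ n ih =>
    rw [Finset.sum_Ico_succ_top (by omega), mul_add, ← add_assoc, add_mul, ih]
    have h1 : ((2 * n + 1) * θ : ℝ) = 2 * ((n + 1 : ℕ) : ℝ) * θ - θ := by push_cast; ring
    have h2 : (2 * ((n + 1 : ℕ) : ℝ) + 1) * θ = 2 * ((n + 1 : ℕ) : ℝ) * θ + θ := by ring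
    rw [h1, h2, Real.sin_sub, Real.sin_add]
    ring

theorem sum_sub_mul_succ (n : ℕ) (c : ℕ → ℝ) :
    ∑ k ∈ Finset.Ico 1 (n + 1), (((n + 1 : ℕ) : ℝ) - k) * c k
      = ∑ k ∈ Finset.Ico 1 n, ((n : ℝ) - k) * c k + ∑ k ∈ Finset.Ico 1 (n + 1), c k := by
  have h : ∑ k ∈ Finset.Ico 1 (n + 1), ((n : ℝ) - k) * c k
      = ∑ k ∈ Finset.Ico 1 n, ((n : ℝ) - k) * c k := by
    rcases Nat.eq_zero_or_pos n with rfl | hn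
    · simp
    · rw [Finset.sum_Ico_succ_top hn]; simp
  rw [← h, ← Finset.sum_add_distrib]
  refine Finset.sum_congr rfl fun k _ => ?_
  push_cast
  ring

theorem add_two_sum_cos_mul_sin_sq (n : ℕ) (θ : ℝ) :
    ((n : ℝ) + 2 * ∑ k ∈ Finset.Ico 1 n, ((n : ℝ) - k) * Real.cos (2 * k * θ)) * Real.sin θ ^ 2
      = Real.sin (n * θ) ^ 2 := by
  induction n with
  | zero => simp
  | succ n ih =>
    rw [sum_sub_mul_succ n fun k => Real.cos (2 * k * θ)]
    have h := one_add_two_sum_cos_mul_sin n θ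
    have h1 : ((2 * n + 1) * θ : ℝ) = n * θ + (n * θ + θ) := by ring
    rw [h1, Real.sin_add, Real.sin_add, Real.cos_add] at h
    have h2 : (((n + 1 : ℕ) : ℝ)) * θ = n * θ + θ := by push_cast; ring
    rw [h2, Real.sin_add]
    push_cast
    linear_combination ih + Real.sin θ * h
      - Real.sin (n * θ) ^ 2 * Real.sin_sq_add_cos_sq θ

theorem fejer_mul_sin_sq (x : ℝ) (i : ℕ) (hi : i ≠ 0) :
    fejer x i * Real.sin (Real.pi * x / i) ^ 2 = Real.sin (Real.pi * x) ^ 2 := by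
  have hi' : (i : ℝ) ≠ 0 := Nat.cast_ne_zero.mpr hi
  have h := add_two_sum_cos_mul_sin_sq i (Real.pi * x / i)
  rw [mul_div_cancel₀ _ hi'] at h
  rw [← h, fejer]
  congr! 6 with k
  ring

theorem fejer_of_sin_eq_zero {x : ℝ} {i : ℕ} (h : Real.sin (Real.pi * x / i) = 0) :
    fejer x i = (i : ℝ) ^ 2 := by
  have hc : ∀ k : ℕ, Real.cos (2 * Real.pi * k * x / i) = 1 := by
    intro k
    obtain ⟨m, hm⟩ := Real.sin_eq_zero_iff.mp h
    have : 2 * Real.pi * k * x / i = ((k * m : ℤ) : ℝ) * (2 * Real.pi) := by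
      push_cast
      linear_combination -(2 * k : ℝ) * hm
    rw [this, Real.cos_int_mul_two_pi]
  have hsum : ∀ n : ℕ, (n : ℝ) + 2 * ∑ k ∈ Finset.Ico 1 n, ((n : ℝ) - k) * 1 = (n : ℝ) ^ 2 := by
    intro n
    induction n with
    | zero => simp
    | succ n ih =>
      rw [sum_sub_mul_succ n fun _ => 1]
      simp only [Finset.sum_const, Nat.card_Ico, nsmul_eq_mul]
      push_cast [Nat.add_sub_cancel]
      linear_combination ih
  simp only [fejer, hc]
  exact hsum i

theorem sin_sq_le_fejer (x : ℝ) (i : ℕ) (hi : i ≠ 0) :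
    Real.sin (Real.pi * x) ^ 2 ≤ fejer x i := by
  have h := fejer_mul_sin_sq x i hi
  by_cases h0 : Real.sin (Real.pi * x / i) = 0
  · rw [← h, h0, fejer_of_sin_eq_zero h0]
    simp only [ne_eq, OfNat.ofNat_ne_zero, not_false_eq_true, zero_pow, mul_zero]
    positivity
  · have hpos : 0 < Real.sin (Real.pi * x / i) ^ 2 := by positivity
    have hf : 0 ≤ fejer x i := by
      by_contra! hneg
      nlinarith [sq_nonneg (Real.sin (Real.pi * x))]
    rw [← h]
    exact mul_le_of_le_one_right hf (Real.sin_sq_le_one _)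

/-! ### The normalized terms `φ_i` -/

theorem sin_sq_div_le_phi (x : ℝ) (i : ℕ) (hi : i ≠ 0) :
    Real.sin (Real.pi * x) ^ 2 / (i : ℝ) ^ 2 ≤ phi i x :=
  div_le_div_of_nonneg_right (sin_sq_le_fejer x i hi) (by positivity)

theorem phi_nonneg (x : ℝ) (i : ℕ) (hi : i ≠ 0) : 0 ≤ phi i x :=
  le_trans (by positivity) (sin_sq_div_le_phi x i hi)

theorem phi_two (x : ℝ) : phi 2 x = Real.cos (Real.pi * x / 2) ^ 2 := by
  have h : 2 * Real.pi * x / 2 = 2 * (Real.pi * x / 2) := by ring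
  simp only [phi, fejer, Nat.Ico_succ_singleton, Finset.sum_singleton, Nat.cast_one,
    Nat.cast_ofNat, mul_one]
  rw [h, Real.cos_two_mul]
  ring

theorem phi_two_odd_sub {p : ℕ} (hodd : Odd p) (t : ℝ) :
    phi 2 (p - t) = Real.sin (Real.pi * t / 2) ^ 2 := by
  obtain ⟨m, rfl⟩ := hodd
  have h : Real.pi * (((2 * m + 1 : ℕ) : ℝ) - t) / 2
      = Real.pi / 2 - Real.pi * t / 2 + m * Real.pi := by push_cast; ring
  rw [phi_two, h, Real.cos_add_nat_mul_pi, mul_pow, ← pow_mul, mul_comm m 2, pow_mul,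
    Real.cos_pi_div_two_sub]
  simp

theorem phi_natCast_self (n : ℕ) (hn : n ≠ 0) : phi n n = 1 := by
  have hn' : (n : ℝ) ≠ 0 := Nat.cast_ne_zero.mpr hn
  rw [phi, fejer_of_sin_eq_zero (by rw [mul_div_cancel_right₀ _ hn', Real.sin_pi])]
  exact div_self (by positivity)

theorem phi_natCast_of_not_dvd (n i : ℕ) (hi : i ≠ 0) (h : ¬ i ∣ n) : phi i n = 0 := by
  have hi' : (i : ℝ) ≠ 0 := Nat.cast_ne_zero.mpr hi
  have hs : Real.sin (Real.pi * n / i) ≠ 0 := by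
    intro h0
    obtain ⟨m, hm⟩ := Real.sin_eq_zero_iff.mp h0
    apply h
    rw [eq_div_iff hi'] at hm
    have hm' : (m : ℝ) * i = n := by
      apply mul_left_cancel₀ Real.pi_ne_zero
      linear_combination hm
    have hz : (n : ℤ) = i * m := by
      rw [mul_comm]
      exact_mod_cast hm'.symm
    exact Int.natCast_dvd_natCast.mp ⟨m, hz⟩
  have hf := fejer_mul_sin_sq n i hi
  rw [mul_comm Real.pi (n : ℝ), Real.sin_nat_mul_pi, mul_comm (n : ℝ) Real.pi] at hf
  have : fejer n i = 0 := by simpa [hs] using hf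
  rw [phi, this, zero_div]

theorem sin_pi_mul_natCast_sub_sq (n : ℕ) (t : ℝ) :
    Real.sin (Real.pi * (n - t)) ^ 2 = Real.sin (Real.pi * t) ^ 2 := by
  have h : Real.pi * (n - t) = n * Real.pi - Real.pi * t := by ring
  rw [h, Real.sin_nat_mul_pi_sub]
  rw [neg_sq, mul_pow, ← pow_mul, mul_comm n 2, pow_mul]
  simp

/-- The second-order lower bound for `φ_n` at its maximum `n`. -/
theorem one_sub_le_phi_natCast_sub {n : ℕ} (hn : n ≠ 0) {t : ℝ} (ht : 0 < t) (ht1 : t < 1) :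
    1 - Real.pi ^ 2 * t ^ 2 / 3 ≤ phi n (n - t) := by
  have hn' : (0 : ℝ) < n := by positivity
  have hn1 : (1 : ℝ) ≤ n := by exact_mod_cast Nat.one_le_iff_ne_zero.mpr hn
  have hy : 0 < Real.pi * t := by positivity
  set y := Real.pi * t with hydef
  have hF := fejer_mul_sin_sq (n - t) n hn
  rw [sin_pi_mul_natCast_sub_sq, ← hydef] at hF
  have harg : Real.pi * (n - t) / n = Real.pi - y / n := by
    rw [hydef]; field_simp
  rw [harg, Real.sin_pi_sub] at hF
  have hF0 : 0 ≤ fejer (n - t) n := le_trans (by positivity) (sin_sq_le_fejer (n - t) n hn)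
  have hle : Real.sin (y / n) ^ 2 ≤ (y / n) ^ 2 := Real.sin_sq_le_sq
  have hphi : phi n (n - t) * y ^ 2 = fejer (n - t) n * (y / n) ^ 2 := by
    rw [phi]; field_simp
  have h1 : Real.sin y ^ 2 ≤ phi n (n - t) * y ^ 2 := by
    rw [hphi, ← hF]
    exact mul_le_mul_of_nonneg_left hle hF0
  have hs0 : 0 ≤ Real.sin y := by
    refine Real.sin_nonneg_of_nonneg_of_le_pi hy.le ?_
    rw [hydef]
    nlinarith [Real.pi_pos]
  have hs := Real.sin_ge_sub_cube hy.le
  have h2 : (1 - y ^ 2 / 3) * y ^ 2 ≤ Real.sin y ^ 2 := by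
    rcases le_total (y - y ^ 3 / 6) 0 with hneg | hpos
    · have : 1 - y ^ 2 / 6 ≤ 0 := by
        by_contra! hc
        nlinarith [mul_pos hy hc]
      nlinarith [sq_nonneg (Real.sin y), sq_nonneg y]
    · have := pow_le_pow_left₀ hpos hs 2
      nlinarith [sq_nonneg (y ^ 3)]
  have h3 : 1 - y ^ 2 / 3 ≤ phi n (n - t) :=
    le_of_mul_le_mul_right (h2.trans h1) (by positivity)
  calc 1 - Real.pi ^ 2 * t ^ 2 / 3 = 1 - y ^ 2 / 3 := by rw [hydef]; ring
    _ ≤ _ := h3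

/-! ### The series `S_q` and the corrector -/

theorem fejerSum_term_nonneg {q : ℝ} (hq : 1 < q) (x : ℝ) (j : ℕ) :
    0 ≤ (q ^ (j + 2))⁻¹ * phi (j + 2) x :=
  mul_nonneg (by positivity) (phi_nonneg x (j + 2) (by omega))

theorem sum_le_fejerSum {q : ℝ} (hq : 1 < q) (x : ℝ) (s : Finset ℕ) :
    ∑ j ∈ s, (q ^ (j + 2))⁻¹ * phi (j + 2) x ≤ fejerSum q x :=
  (summable_fejerSum hq x).sum_le_tsum s fun j _ => fejerSum_term_nonneg hq x j

theorem sin_sq_mul_fejerMass_le_fejerSum {q : ℝ} (hq : 1 < q) (x : ℝ) :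
    Real.sin (Real.pi * x) ^ 2 * fejerMass q ≤ fejerSum q x := by
  rw [fejerMass, ← tsum_mul_left]
  refine ((summable_fejerMass hq).mul_left _).tsum_le_tsum (fun j => ?_) (summable_fejerSum hq x)
  have h := mul_le_mul_of_nonneg_left (sin_sq_div_le_phi x (j + 2) (by omega))
    (by positivity : 0 ≤ (q ^ (j + 2))⁻¹)
  calc _ = (q ^ (j + 2))⁻¹ * (Real.sin (Real.pi * x) ^ 2 / ((j + 2 : ℕ) : ℝ) ^ 2) := by ring
    _ ≤ _ := h

theorem fejerMass_pos {q : ℝ} (hq : 1 < q) : 0 < fejerMass q :=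
  (summable_fejerMass hq).tsum_pos (fun j => by positivity) 0 (by positivity)

theorem fejerSum_prime {q : ℝ} {p : ℕ} (hp : p.Prime) :
    fejerSum q p = (q ^ p)⁻¹ := by
  have h2 := hp.two_le
  have hp2 : p - 2 + 2 = p := by omega
  rw [fejerSum, tsum_eq_single (p - 2), hp2, phi_natCast_self p hp.ne_zero, mul_one]
  intro j hj
  rw [phi_natCast_of_not_dvd p (j + 2) (by omega), mul_zero]
  intro hdvd
  rcases (Nat.dvd_prime hp).mp hdvd with h | h <;> omega

theorem FSharp_eq (x q : ℝ) :
    FSharp x q = (q - 1) * q *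
      (fejerSum q x - q ^ (-x) * (1 + Real.log q * periodicNormalizer x)) := by
  rw [FSharp, corrector]
  ring

theorem FSharp_pos_of_lt {q : ℝ} (hq : 1 < q) {x : ℝ}
    (h : q ^ (-x) * (1 + Real.log q * periodicNormalizer x) < fejerSum q x) :
    0 < FSharp x q := by
  rw [FSharp_eq]
  exact mul_pos (mul_pos (by linarith) (by linarith)) (by linarith)

theorem FSharp_prime {q : ℝ} (hq : 1 < q) {p : ℕ} (hp : p.Prime) : FSharp p q = 0 := by
  have hs : periodicNormalizer p = 0 := by
    have hang : 2 * Real.pi * p = ((2 * p : ℕ) : ℝ) * Real.pi := by push_cast; ring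
    rw [periodicNormalizer, hang, Real.sin_nat_mul_pi, zero_div]
  rw [FSharp_eq, hs, fejerSum_prime hp, Real.rpow_neg (by linarith), Real.rpow_natCast]
  simp

theorem LambdaSin_pos {q : ℝ} (hq : 1 < q) : 0 < LambdaSin q := by
  have := Real.log_pos hq
  unfold LambdaSin
  positivity

theorem one_add_log_mul_periodicNormalizer_le {q : ℝ} (hq : 1 < q) (x : ℝ) :
    1 + Real.log q * periodicNormalizer x ≤ LambdaSin q := by
  have hL := Real.log_pos hq
  have h : periodicNormalizer x ≤ 1 / (2 * Real.pi) :=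
    div_le_div_of_nonneg_right (Real.sin_le_one _) (by positivity)
  have := mul_le_mul_of_nonneg_left h hL.le
  rw [mul_one_div] at this
  unfold LambdaSin
  linarith

/-- How each logarithmic entry of the threshold `P_0(q)` is used. -/
theorem rpow_neg_mul_le_of_log_div_le {q Λ m c : ℝ} (hq : 1 < q) (hΛ : 0 < Λ) (hm : 0 < m)
    (h : Real.log (Λ / m) / Real.log q ≤ c) : q ^ (-c) * Λ ≤ m := by
  have hq0 : 0 < q := by linarith
  rw [div_le_iff₀ (Real.log_pos hq)] at h
  have h1 : Λ / m ≤ q ^ c := by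
    rw [Real.rpow_def_of_pos hq0, ← Real.log_le_iff_le_exp (by positivity)]
    linarith
  rw [div_le_iff₀ hm] at h1
  rw [Real.rpow_neg hq0.le, inv_mul_le_iff₀ (by positivity)]
  exact h1

/-! ### Positivity of the matching radius -/

theorem K0_pos {q : ℝ} (hq : 1 < q) : 0 < K0 q := by
  have hq0 : 0 < q := by linarith
  have hL0 := Real.log_pos hq
  have hL : Real.log q ≤ q - 1 := Real.log_le_sub_one_of_pos hq0
  have hpi := Real.pi_gt_three
  have key : 0 < Real.pi ^ 2 / 2 * q ^ 3 + 8 * Real.pi ^ 2 / 27 * q ^ 2 + Real.pi ^ 2 / 4 * q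
      - (2 * Real.pi ^ 2 / 3 + Real.log q ^ 2) := by
    have hP : 9 < Real.pi ^ 2 := by nlinarith
    have hL2 : Real.log q ^ 2 ≤ (q - 1) ^ 2 := pow_le_pow_left₀ hL0.le hL 2
    have h2 : q < q ^ 2 := by nlinarith
    have h3 : q ^ 2 < q ^ 3 := by nlinarith
    have hb : 0 < 1 / 2 * q ^ 3 + 8 / 27 * q ^ 2 + 1 / 4 * q - 2 / 3 := by linarith
    nlinarith [mul_pos (sub_pos.mpr hP) hb]
  have : CSin' q = (1 / 2) * ((q ^ 5)⁻¹ * (Real.pi ^ 2 / 2 * q ^ 3 + 8 * Real.pi ^ 2 / 27 * q ^ 2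
      + Real.pi ^ 2 / 4 * q - (2 * Real.pi ^ 2 / 3 + Real.log q ^ 2))) := by
    unfold CSin'
    field_simp
  rw [K0, this]
  positivity

theorem C3tot_pos {q : ℝ} (hq : 1 < q) : 0 < C3tot q := by
  have hL := Real.log_pos hq
  have h : 0 < 1 - 1 / q := by
    rw [sub_pos, div_lt_one (by linarith)]
    exact hq
  unfold C3tot
  positivity

theorem alpha_pos {q : ℝ} (hq : 1 < q) : 0 < alpha q := by
  have h1 := K0_pos hq
  have h2 := C3tot_pos hq
  have h3 : 0 < deltaSin q := lt_min one_pos (by positivity)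
  exact lt_min (by norm_num) (by positivity)

theorem alpha_le (q : ℝ) : alpha q ≤ 1 / 4 := min_le_left _ _

/-! ### The three parts of the window -/

/-- Just above `p - 1` the single term `φ_2` beats the corrector. -/
theorem corrector_lt_fejerSum_near_pred {q : ℝ} (hq : 1 < q) {p : ℕ} (hodd : Odd p) {a x : ℝ}
    (ha1 : a < 1)
    (hP : 3 + Real.log (LambdaSin q / Real.cos (Real.pi * a / 2) ^ 2) / Real.log q ≤ p)
    (hx : (p : ℝ) - 1 < x) (hxa : x ≤ p - 1 + a) :
    q ^ (-x) * (1 + Real.log q * periodicNormalizer x) < fejerSum q x := by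
  have hpi := Real.pi_pos
  have hq0 : 0 < q := by linarith
  have hΛ := LambdaSin_pos hq
  have hcos : 0 < Real.cos (Real.pi * a / 2) :=
    Real.cos_pos_of_mem_Ioo ⟨by nlinarith, by nlinarith⟩
  have h1 := rpow_neg_mul_le_of_log_div_le hq hΛ (pow_pos hcos 2)
    (by linarith : _ ≤ (p : ℝ) - 3)
  have hphi : Real.cos (Real.pi * a / 2) ^ 2 ≤ phi 2 x := by
    have hx' : x = p - (p - x) := by ring
    have hang : Real.pi * (p - x) / 2 = Real.pi / 2 - Real.pi * (x - (p - 1)) / 2 := by ring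
    rw [hx', phi_two_odd_sub hodd, hang, Real.sin_pi_div_two_sub]
    refine pow_le_pow_left₀ hcos.le (Real.cos_le_cos_of_nonneg_of_le_pi ?_ ?_ ?_) 2
    · have := mul_pos hpi (sub_pos.mpr hx); linarith
    · nlinarith
    · nlinarith
  have hS := sum_le_fejerSum hq x {0}
  simp only [Finset.sum_singleton, zero_add] at hS
  have hsplit : q ^ (-((p : ℝ) - 1)) = (q ^ 2)⁻¹ * q ^ (-((p : ℝ) - 3)) := by
    rw [← Real.rpow_natCast, ← Real.rpow_neg hq0.le, ← Real.rpow_add hq0]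
    congr 1
    push_cast
    ring
  calc q ^ (-x) * (1 + Real.log q * periodicNormalizer x)
      ≤ q ^ (-x) * LambdaSin q := mul_le_mul_of_nonneg_left
        (one_add_log_mul_periodicNormalizer_le hq x) (by positivity)
    _ < q ^ (-((p : ℝ) - 1)) * LambdaSin q :=
        mul_lt_mul_of_pos_right (Real.rpow_lt_rpow_of_exponent_lt hq (by linarith)) hΛ
    _ = (q ^ 2)⁻¹ * (q ^ (-((p : ℝ) - 3)) * LambdaSin q) := by rw [hsplit, mul_assoc]
    _ ≤ (q ^ 2)⁻¹ * phi 2 x := mul_le_mul_of_nonneg_left (h1.trans hphi) (by positivity)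
    _ ≤ fejerSum q x := hS

/-- In the middle of the window the uniform bound `φ_i(x) ≥ sin² (π x) / i²` suffices. -/
theorem corrector_lt_fejerSum_middle {q : ℝ} (hq : 1 < q) {p : ℕ} {a x : ℝ}
    (ha : 0 < a) (ha1 : a ≤ 1 / 2)
    (hP : 1 + a + Real.log (LambdaSin q / (Real.sin (Real.pi * a) ^ 2 * fejerMass q)) / Real.log q
      ≤ p)
    (hx : (p : ℝ) - 1 + a ≤ x) (hxa : x ≤ p - a) :
    q ^ (-x) * (1 + Real.log q * periodicNormalizer x) < fejerSum q x := by
  have hpi := Real.pi_pos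
  have hΛ := LambdaSin_pos hq
  have hM := fejerMass_pos hq
  have hsin : 0 < Real.sin (Real.pi * a) :=
    Real.sin_pos_of_pos_of_lt_pi (by positivity) (by nlinarith)
  have h1 := rpow_neg_mul_le_of_log_div_le hq hΛ (mul_pos (pow_pos hsin 2) hM)
    (by linarith : _ ≤ (p : ℝ) - 1 - a)
  have hle : Real.sin (Real.pi * a) ≤ Real.sin (Real.pi * (p - x)) := by
    rcases le_total (p - x) (1 / 2) with h | h
    · exact Real.sin_le_sin_of_le_of_le_pi_div_two (by nlinarith) (by nlinarith) (by nlinarith)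
    · rw [← Real.sin_pi_sub (Real.pi * (p - x))]
      exact Real.sin_le_sin_of_le_of_le_pi_div_two (by nlinarith) (by nlinarith) (by nlinarith)
  have hsq : Real.sin (Real.pi * a) ^ 2 ≤ Real.sin (Real.pi * x) ^ 2 := by
    have h := sin_pi_mul_natCast_sub_sq p (p - x)
    rw [sub_sub_cancel] at h
    rw [h]
    exact pow_le_pow_left₀ hsin.le hle 2
  calc q ^ (-x) * (1 + Real.log q * periodicNormalizer x)
      ≤ q ^ (-x) * LambdaSin q := mul_le_mul_of_nonneg_left
        (one_add_log_mul_periodicNormalizer_le hq x) (by positivity)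
    _ < q ^ (-((p : ℝ) - 1 - a)) * LambdaSin q :=
        mul_lt_mul_of_pos_right (Real.rpow_lt_rpow_of_exponent_lt hq (by linarith)) hΛ
    _ ≤ Real.sin (Real.pi * a) ^ 2 * fejerMass q := h1
    _ ≤ Real.sin (Real.pi * x) ^ 2 * fejerMass q := mul_le_mul_of_nonneg_right hsq hM.le
    _ ≤ fejerSum q x := sin_sq_mul_fejerMass_le_fejerSum hq x

theorem mul_le_sin_pi_mul {t : ℝ} (ht : 0 ≤ t) (ht4 : t ≤ 1 / 4) :
    2.8 * t ≤ Real.sin (Real.pi * t) := by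
  have h := Real.sin_ge_sub_cube (mul_nonneg Real.pi_pos.le ht)
  have h1 := Real.pi_gt_d2
  have h2 := Real.pi_lt_d2
  have h3 : Real.pi ^ 3 ≤ 3.15 ^ 3 := pow_le_pow_left₀ Real.pi_pos.le h2.le 3
  have h4 : t ^ 2 ≤ 1 / 16 := by nlinarith
  have h5 : 2.8 ≤ Real.pi - Real.pi ^ 3 * t ^ 2 / 6 := by
    nlinarith [mul_le_mul h3 h4 (sq_nonneg t) (by norm_num)]
  nlinarith [mul_le_mul_of_nonneg_right h5 ht]

theorem mul_le_sin_pi_mul_div_two {t : ℝ} (ht : 0 ≤ t) (ht4 : t ≤ 1 / 4) :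
    1.52 * t ≤ Real.sin (Real.pi * t / 2) := by
  have h := Real.sin_ge_sub_cube (by have := Real.pi_pos; positivity : 0 ≤ Real.pi * t / 2)
  have h1 := Real.pi_gt_d2
  have h2 := Real.pi_lt_d2
  have h3 : Real.pi ^ 3 ≤ 3.15 ^ 3 := pow_le_pow_left₀ Real.pi_pos.le h2.le 3
  have h4 : t ^ 2 ≤ 1 / 16 := by nlinarith
  have h5 : 1.52 ≤ Real.pi / 2 - Real.pi ^ 3 * t ^ 2 / 48 := by
    nlinarith [mul_le_mul h3 h4 (sq_nonneg t) (by norm_num)]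
  nlinarith [mul_le_mul_of_nonneg_right h5 ht]

/-- The corrector exceeds its value `q^{-n}` at an integer `n ≥ 5` by a small multiple of
`q^{-2} t²` at distance `t ≤ 1/4` to the left of `n`. -/
theorem corrector_natCast_sub_le {q : ℝ} (hq : 1 < q) {n : ℕ} (hn : 5 ≤ n) {t : ℝ} (ht : 0 < t)
    (ht4 : t ≤ 1 / 4) :
    q ^ (-((n : ℝ) - t)) * (1 + Real.log q * periodicNormalizer (n - t))
      ≤ (q ^ n)⁻¹ + 0.264 * (q ^ 2)⁻¹ * t ^ 2 := by
  have hq0 : 0 < q := by linarith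
  have hL := Real.log_pos hq
  have hpi := Real.pi_pos
  have hn' : (5 : ℝ) ≤ n := by exact_mod_cast hn
  set L := Real.log q with hLdef
  have hS1 : periodicNormalizer (n - t) ≤ -(t - 1.65 * t ^ 2) := by
    have harg : 2 * Real.pi * (n - t) = n * (2 * Real.pi) - 2 * Real.pi * t := by ring
    have h := Real.sin_ge_sub_cube (by positivity : 0 ≤ 2 * Real.pi * t)
    rw [periodicNormalizer, harg, Real.sin_nat_mul_two_pi_sub, div_le_iff₀ (by positivity)]
    have h2 : Real.pi ^ 2 ≤ 9.9 := by nlinarith [Real.pi_lt_d4]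
    have h3 : (2 * Real.pi * t) ^ 3 / 6 ≤ 2 * Real.pi * (1.65 * t ^ 2) := by
      have : Real.pi ^ 2 * t ≤ 9.9 * (1 / 4) := mul_le_mul h2 ht4 ht.le (by norm_num)
      have h4 := mul_le_mul_of_nonneg_right this (by positivity : 0 ≤ Real.pi * t ^ 2)
      nlinarith
    linarith
  have hmul := mul_le_mul_of_nonneg_left hS1 hL.le
  have hsplit1 : q ^ (-((n : ℝ) - t)) = (q ^ n)⁻¹ * Real.exp (L * t) := by
    rw [neg_sub, sub_eq_add_neg, add_comm, Real.rpow_add hq0, Real.rpow_neg hq0.le,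
      Real.rpow_natCast, Real.rpow_def_of_pos hq0]
  have hsplit2 : q ^ (-((n : ℝ) - t)) ≤ (q ^ 2)⁻¹ * Real.exp (-(2.75 * L)) := by
    have : (q ^ 2)⁻¹ * Real.exp (-(2.75 * L)) = q ^ (-4.75 : ℝ) := by
      rw [show (-4.75 : ℝ) = -((2 : ℕ) : ℝ) + (-2.75) by norm_num, Real.rpow_add hq0,
        Real.rpow_neg hq0.le, Real.rpow_natCast, Real.rpow_def_of_pos hq0]
      congr 2
      ring
    rw [this]
    exact Real.rpow_le_rpow_of_exponent_le hq.le (by linarith)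
  -- `s e^{-s}` is bounded, so `log q * q^{-2.75}` is bounded uniformly in `q`.
  have hexp : Real.exp (-(2.75 * L)) * L ≤ 0.16 := by
    have h := Real.quadratic_le_exp_of_nonneg (by positivity : 0 ≤ 2.75 * L)
    rw [Real.exp_neg, inv_mul_le_iff₀ (Real.exp_pos _)]
    nlinarith [sq_nonneg (L - 0.5)]
  have htangent : Real.exp (L * t) * (1 - L * t) ≤ 1 := by
    have h := Real.one_sub_le_exp_neg (L * t)
    calc _ ≤ Real.exp (L * t) * Real.exp (-(L * t)) :=
          mul_le_mul_of_nonneg_left h (Real.exp_pos _).le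
      _ = 1 := by rw [← Real.exp_add, add_neg_cancel, Real.exp_zero]
  have hfirst : q ^ (-((n : ℝ) - t)) * (1 - L * t) ≤ (q ^ n)⁻¹ := by
    rw [hsplit1, mul_assoc]
    exact mul_le_of_le_one_right (by positivity) htangent
  have hsecond : q ^ (-((n : ℝ) - t)) * L ≤ (q ^ 2)⁻¹ * 0.16 :=
    calc _ ≤ (q ^ 2)⁻¹ * Real.exp (-(2.75 * L)) * L := mul_le_mul_of_nonneg_right hsplit2 hL.le
      _ = (q ^ 2)⁻¹ * (Real.exp (-(2.75 * L)) * L) := mul_assoc _ _ _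
      _ ≤ _ := mul_le_mul_of_nonneg_left hexp (by positivity)
  calc q ^ (-((n : ℝ) - t)) * (1 + L * periodicNormalizer (n - t))
      ≤ q ^ (-((n : ℝ) - t)) * (1 + L * -(t - 1.65 * t ^ 2)) :=
        mul_le_mul_of_nonneg_left (by linarith) (by positivity)
    _ = q ^ (-((n : ℝ) - t)) * (1 - L * t) + q ^ (-((n : ℝ) - t)) * L * (1.65 * t ^ 2) := by ring
    _ ≤ (q ^ n)⁻¹ + (q ^ 2)⁻¹ * 0.16 * (1.65 * t ^ 2) :=
        add_le_add hfirst (mul_le_mul_of_nonneg_right hsecond (by positivity))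
    _ = _ := by ring

/-- To the left of an odd integer `p ≥ 5` the terms `i = 2, 3, 4` outweigh the loss of `φ_p` against
the corrector. -/
theorem corrector_lt_fejerSum_near_prime {q : ℝ} (hq : 1 < q) {p : ℕ} (hodd : Odd p)
    (hp5 : 5 ≤ p) {t : ℝ} (ht : 0 < t) (ht4 : t ≤ 1 / 4) :
    q ^ (-((p : ℝ) - t)) * (1 + Real.log q * periodicNormalizer (p - t))
      < fejerSum q (p - t) := by
  have hG := corrector_natCast_sub_le hq hp5 ht ht4
  have hS := sum_le_fejerSum hq (p - t) {0, 1, 2, p - 2}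
  rw [Finset.sum_insert (by simp; omega), Finset.sum_insert (by simp; omega),
    Finset.sum_insert (by simp; omega), Finset.sum_singleton,
    show p - 2 + 2 = p by omega] at hS
  norm_num only at hS
  have hs2 : 7.84 * t ^ 2 ≤ Real.sin (Real.pi * t) ^ 2 := by
    have := pow_le_pow_left₀ (by positivity) (mul_le_sin_pi_mul ht.le ht4) 2
    linarith
  have h2 : 2.31 * t ^ 2 ≤ phi 2 (p - t) := by
    rw [phi_two_odd_sub hodd]
    have := pow_le_pow_left₀ (by positivity) (mul_le_sin_pi_mul_div_two ht.le ht4) 2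
    nlinarith [sq_nonneg t]
  have h3 : 0.871 * t ^ 2 ≤ phi 3 (p - t) := by
    have h := sin_sq_div_le_phi (p - t) 3 (by norm_num)
    rw [sin_pi_mul_natCast_sub_sq] at h
    norm_num only [Nat.cast_ofNat] at h
    nlinarith [sq_nonneg t]
  have h4 : 0.49 * t ^ 2 ≤ phi 4 (p - t) := by
    have h := sin_sq_div_le_phi (p - t) 4 (by norm_num)
    rw [sin_pi_mul_natCast_sub_sq] at h
    norm_num only [Nat.cast_ofNat] at h
    nlinarith [sq_nonneg t]
  have hp : 1 - 3.3 * t ^ 2 ≤ phi p (p - t) := by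
    have h := one_sub_le_phi_natCast_sub (by omega : p ≠ 0) ht (by linarith)
    have : Real.pi ^ 2 ≤ 9.9 := by nlinarith [Real.pi_lt_d4, Real.pi_pos]
    nlinarith [mul_le_mul_of_nonneg_right this (sq_nonneg t)]
  have hpow : ∀ m n : ℕ, m ≤ n → (q ^ n)⁻¹ ≤ (q ^ m)⁻¹ := fun m n h =>
    inv_anti₀ (by positivity) (pow_le_pow_right₀ hq.le h)
  have ht2 : 0 < t ^ 2 := by positivity
  have hp0 : 0 < (q ^ p)⁻¹ := by positivity
  have e2 := mul_le_mul_of_nonneg_left h2 (by positivity : 0 ≤ (q ^ 2)⁻¹)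
  have e3 := mul_le_mul_of_nonneg_left h3 (by positivity : 0 ≤ (q ^ 3)⁻¹)
  have e4 := mul_le_mul_of_nonneg_left h4 (by positivity : 0 ≤ (q ^ 4)⁻¹)
  have ep := mul_le_mul_of_nonneg_left hp hp0.le
  have d2 := mul_le_mul_of_nonneg_right (hpow 2 p (by omega)) ht2.le
  have d3 := mul_le_mul_of_nonneg_right (hpow 3 p (by omega)) ht2.le
  have d4 := mul_le_mul_of_nonneg_right (hpow 4 p (by omega)) ht2.le
  -- All weights `q^{-i}` exceed `q^{-p}`, and `(2.31 - 0.264) + 0.871 + 0.49 > 3.3`.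
  have hpt : 0 < (q ^ p)⁻¹ * t ^ 2 := by positivity
  linarith

end FejerIndicator

end

theorem mainTheorem2 (q : ℝ) (hq : 1 < q) (p : ℕ) (hp : p.Prime) (hodd : Odd p)
    (hP : FejerIndicator.P0 q ≤ (p : ℝ)) :
    (∀ x ∈ Set.Ioo ((p : ℝ) - 1) (p : ℝ), 0 < FejerIndicator.FSharp x q) ∧
      FejerIndicator.FSharp (p : ℝ) q = 0 ∧
      (∀ x ∈ Set.Ioo ((p : ℝ) - 1) (p : ℝ), FejerIndicator.FSharp x q ≠ 0) := by
  have hpos : ∀ x ∈ Set.Ioo ((p : ℝ) - 1) (p : ℝ), 0 < FejerIndicator.FSharp x q := by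
    rintro x ⟨hx1, hx2⟩
    obtain ⟨hP1, hP'⟩ := max_le_iff.mp hP
    obtain ⟨hP2, hP3⟩ := max_le_iff.mp hP'
    have ha := FejerIndicator.alpha_pos hq
    have ha4 := FejerIndicator.alpha_le q
    apply FejerIndicator.FSharp_pos_of_lt hq
    rcases le_total x (p - 1 + FejerIndicator.alpha q) with h | h
    · exact FejerIndicator.corrector_lt_fejerSum_near_pred hq hodd (by linarith) hP1 hx1 h
    rcases le_total x (p - FejerIndicator.alpha q) with h' | h'
    · exact FejerIndicator.corrector_lt_fejerSum_middle hq ha (by linarith) hP2 h h'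
    · have := FejerIndicator.corrector_lt_fejerSum_near_prime hq hodd (by exact_mod_cast hP3)
        (t := p - x) (by linarith) (by linarith)
      rwa [sub_sub_cancel] at this
  exact ⟨hpos, FejerIndicator.FSharp_prime hq hp, fun x hx => (hpos x hx).ne'⟩
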